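/- **Theorem 4.** For an irrational number $\alpha$, the irrationality base $\beta(\alpha)$ is the least real number $\beta>0$ (if there is one) such that for every $\varepsilon>0$ there is a positive integer $q(\varepsilon)$ with $|\alpha-p/q|>(\beta+\varepsilon)^{-q}$ for all integers $p,q$ with $q\ge q(\varepsilon)$. A real number $\theta$ is approximable to order $\omega$ if for every $C>0$ there are integers $p,q$ with $q>C$ and $|\theta-p/q|<\omega(q)$. Let $\beta>1$ be real. Construct rational numbers $r_1,r_2,\dots$ as follows, writing $b_n$ for the denominator of $r_n$ in lowest terms and $t_0=1$, $t_n=b_n^{t_{n-1}}$ for $n\ge1$. * If $\beta=b/a$ is rational in lowest terms, $0<a<b$, put $r_n=a/b$ for all $n\ge1$. * If $\beta$ is irrational, write $1-\beta^{-1}=\sum_{j\ge1}2^{-k_j}$ with $0<k_1<k_2<\cdots$, and put $S_j=\sum_{i=1}^{j}2^{-k_i}$, $n_0=0$. Choose successively $n_1<n_2<\cdots$ (with $n_1>0$), setting $r_n=1-S_j$ for $n_{j-1}<n\le n_j$, such that $2^{k_{j+1}}\le t_{n_j}$ for all $j\ge1$. Such a construction is always possible, and, for all choices made in it, the series $$\tau_\beta=\sum_{n=1}^{\infty}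 r_n^{\,t_{n-1}}$$ converges to an irrational number whose irrationality base is $\beta$. Moreover, $$\left|\tau_\beta-\frac pq\right|>\frac1{\beta^{q}}\quad\text{for all integers } p,q \text{ with } q>0 \text{ sufficiently large},$$ so that $\tau_\beta$ is not approximable to order $\beta^{-x}$. If $\beta=b/a$ is rational in lowest terms with $b>0$, then $$\tau_\beta=\beta^{-1}+\beta^{-b}+\beta^{-b^{b}}+\beta^{-b^{b^{b}}}+\cdots .$$ -/

import Mathlib

/-- `b` has the property that for every `ε > 0`, one has `|α - p/q| > 1/(b + ε)^q` for all
integers `p, q` with `q` at least some positive `q(ε)`. -/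
def BoundsIrrationality (α b : ℝ) : Prop :=
  ∀ ε : ℝ, 0 < ε → ∃ Q : ℕ, 0 < Q ∧
    ∀ (p : ℤ) (q : ℕ), Q ≤ q → 1 / (b + ε) ^ q < |α - (p : ℝ) / (q : ℝ)|

/-- The irrational number `α` has (finite) irrationality base `β`: `β` is the least positive real
number with the property above. -/
def HasIrrationalityBase (α β : ℝ) : Prop :=
  Irrational α ∧ IsLeast {b : ℝ | 0 < b ∧ BoundsIrrationality α b} β

/-- `θ` is approximable to order `ω`: there are integers `p, q` with `q` arbitrarily large and
`|θ - p/q| < ω(q)`. -/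
def ApproximableToOrder (θ : ℝ) (ω : ℝ → ℝ) : Prop :=
  ∀ C : ℝ, 0 < C → ∃ (p : ℤ) (q : ℕ), C < (q : ℝ) ∧ |θ - (p : ℝ) / (q : ℝ)| < ω q

/-- The tower `t 0 = 1`, `t n = b n ^ t (n - 1)`, attached to `b 1, b 2, …`
(the value `b 0` is not used). -/
def tower (b : ℕ → ℕ) : ℕ → ℕ
  | 0 => 1
  | n + 1 => b (n + 1) ^ tower b n

/-- The tower attached to the denominators (in lowest terms) of the rationals `r 1, r 2, …`. -/
def denTower (r : ℕ → ℚ) : ℕ → ℕ := tower (fun n => (r n).den)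

/-- The terms `r 1, r 2 ^ t 1, r 3 ^ t 2, …` of the series attached to `r 1, r 2, …`. -/
noncomputable def seriesTerm (r : ℕ → ℚ) (n : ℕ) : ℝ := (r (n + 1) : ℝ) ^ denTower r n

/-- `x = 2^(-k 0) + 2^(-k 1) + ⋯` with `0 < k 0 < k 1 < ⋯`. -/
def IsBinaryExpansion (x : ℝ) (k : ℕ → ℕ) : Prop :=
  0 < k 0 ∧ StrictMono k ∧ HasSum (fun i => 1 / (2 : ℝ) ^ k i) x

/-- The sequence `r 1, r 2, …` is one produced by the construction for `β` (`r 0` is not used).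

* If `β = b / a` is rational, in lowest terms, then `r n = a / b` for all `n ≥ 1`.
* If `β` is irrational, let `1 - 1/β = 2^(-k 0) + 2^(-k 1) + ⋯` in base 2, and denote by
  `S j` the sum of the first `j` terms, whose denominator is `B j = 2 ^ k (j - 1)`.
  Choose `0 = N 0 < N 1 < N 2 < ⋯` successively, with `r n = 1 - S (j + 1)` on the block
  `N j < n ≤ N (j + 1)`, the block being so long that the tower at its end is at least the next
  denominator `B (j + 2)`. (As `1 - S j` also has denominator `B j`, that tower is `denTower r`.) -/
inductive IsConstructedSequence (β : ℝ) (r : ℕ → ℚ) : Prop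
  | rational (a b : ℕ) (a_pos : 0 < a) (a_lt_b : a < b) (coprime : Nat.Coprime a b)
      (beta_eq : β = (b : ℝ) / (a : ℝ))
      (r_eq : ∀ n : ℕ, 1 ≤ n → r n = (a : ℚ) / (b : ℚ)) : IsConstructedSequence β r
  | irrational (beta_irrational : Irrational β) (k N : ℕ → ℕ)
      (expansion : IsBinaryExpansion (1 - 1 / β) k)
      (N_zero : N 0 = 0) (N_strictMono : StrictMono N)
      (r_eq : ∀ j n : ℕ, N j < n → n ≤ N (j + 1) →
        r n = 1 - ∑ i ∈ Finset.range (j + 1), 1 / (2 : ℚ) ^ k i)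
      (block_long : ∀ j : ℕ, 2 ^ k (j + 1) ≤ denTower r (N (j + 1))) : IsConstructedSequence β r

/-!
The partial sum `s n` of `n` terms of the series has denominator exactly `t n`: its last term is in
lowest terms over `t n`, and every prime of `t n` divides `t n` to a higher power than the
denominator `t (n - 1)` of the other terms. The error `τ - s n` is positive and of the size of the
next term `r (n + 1) ^ t n`, where `r n` decreases to `1/β`. Hence `s n` shows
that no base below `β` works, while `τ - s n > β ^ (-t n)`.

For `p/q ≠ s n`, the distance from `s n` to `p/q` is at least `1 / (q * t n)`, which dwarfs
`τ - s n` as long as `q ≤ t n ^ 2`. With `t n ≤ q < t (n + 1)`, this is used with `s n` when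
`q ≤ t n ^ 2`, and with `s (n + 1)` otherwise: its denominator exceeds `q`, so `p/q ≠ s (n + 1)`,
and `t (n + 1)`, which is at most `t n ^ t n` for large `n`, is still much smaller than `β ^ q`.
-/

open Filter Topology

section RationalApproximation

/-- The form of `BoundsIrrationality` without `ε`: every rational `p/q` with `q` large is at
distance more than `b ^ (-q)` from `α`. -/
def AvoidsRationals (α b : ℝ) : Prop :=
  ∃ Q : ℕ, 0 < Q ∧ ∀ (p : ℤ) (q : ℕ), Q ≤ q → 1 / b ^ q < |α - (p : ℝ) / (q : ℝ)|

variable {α b c : ℝ}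

theorem avoidsRationals_iff_eventually :
    AvoidsRationals α b ↔ ∀ᶠ q : ℕ in atTop, ∀ p : ℤ, 1 / b ^ q < |α - (p : ℝ) / (q : ℝ)| := by
  refine ⟨fun ⟨Q, _, h⟩ => eventually_atTop.2 ⟨Q, fun q hq p => h p q hq⟩, fun h => ?_⟩
  obtain ⟨Q, hQ⟩ := eventually_atTop.1 h
  exact ⟨Q + 1, Q.succ_pos, fun p q hq => hQ q (by lia) p⟩

namespace AvoidsRationals

theorem mono (h : AvoidsRationals α b) (hb : 0 < b) (hbc : b ≤ c) : AvoidsRationals α c := by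
  obtain ⟨Q, hQ, hlt⟩ := h
  refine ⟨Q, hQ, fun p q hq => lt_of_le_of_lt ?_ (hlt p q hq)⟩
  gcongr

theorem boundsIrrationality (h : AvoidsRationals α b) (hb : 0 < b) : BoundsIrrationality α b :=
  fun _ hε => h.mono hb (le_add_of_nonneg_right hε.le)

theorem irrational (h : AvoidsRationals α b) (hb : 0 ≤ b) : Irrational α := by
  rintro ⟨x, rfl⟩
  obtain ⟨Q, hQ, hlt⟩ := h
  have hx : (x : ℝ) = ((Q * x.num : ℤ) : ℝ) / ((Q * x.den : ℕ) : ℝ) := by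
    push_cast
    rw [mul_div_mul_left _ _ (by positivity), ← Rat.cast_def]
  have hdist := hlt (Q * x.num) (Q * x.den) (Nat.le_mul_of_pos_right _ x.den_pos)
  rw [← hx, sub_self, abs_zero] at hdist
  exact hdist.not_ge (by positivity)

theorem not_approximableToOrder (h : AvoidsRationals α b) (hb : 0 ≤ b) :
    ¬ ApproximableToOrder α (fun x => b ^ (-x)) := by
  intro hα
  obtain ⟨Q, hQ, hlt⟩ := h
  obtain ⟨p, q, hq, hpq⟩ := hα Q (by exact_mod_cast hQ)
  have hfar := hlt p q (by exact_mod_cast hq.le)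
  simp only [Real.rpow_neg hb, Real.rpow_natCast, ← one_div] at hpq
  exact lt_asymm hfar hpq

theorem hasIrrationalityBase (h : AvoidsRationals α b) (hb : 0 < b)
    (hmin : ∀ c, 0 < c → c < b → ¬ AvoidsRationals α c) : HasIrrationalityBase α b := by
  refine ⟨h.irrational hb.le, ⟨hb, h.boundsIrrationality hb⟩, fun c ⟨hc, hcα⟩ => ?_⟩
  by_contra! hcb
  exact hmin (c + (b - c) / 2) (by linarith) (by linarith) (hcα ((b - c) / 2) (by linarith))

end AvoidsRationals

theorem one_div_le_abs_sub_of_ne (s : ℚ) (p : ℤ) {q : ℕ} (hq : 0 < q) (h : (p : ℚ) / q ≠ s) :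
    1 / ((q : ℝ) * s.den) ≤ |(s : ℝ) - p / q| := by
  have hs : (s.den : ℝ) ≠ 0 := by exact_mod_cast s.den_ne_zero
  have hsub : (s : ℝ) - p / q = (s.num * q - p * s.den : ℤ) / (q * s.den) := by
    rw [Rat.cast_def]
    push_cast
    field_simp
  have hne : s.num * q - p * s.den ≠ 0 := by
    intro h0
    rw [h0, Int.cast_zero, zero_div, sub_eq_zero] at hsub
    exact h (by exact_mod_cast hsub.symm)
  have hone : (1 : ℝ) ≤ |((s.num * q - p * s.den : ℤ) : ℝ)| := by
    exact_mod_cast Int.one_le_abs hne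
  rw [hsub, abs_div, abs_of_nonneg (by positivity : (0 : ℝ) ≤ q * s.den)]
  gcongr

theorem one_div_two_mul_le_abs_sub_of_ne (s : ℚ) (p : ℤ) {q : ℕ} (hq : 0 < q)
    (h : (p : ℚ) / q ≠ s) (hα : |α - s| ≤ 1 / (2 * ((q : ℝ) * s.den))) :
    1 / (2 * ((q : ℝ) * s.den)) ≤ |α - p / q| := by
  have hsep := one_div_le_abs_sub_of_ne s p hq h
  have htri : |(s : ℝ) - p / q| ≤ |α - s| + |α - p / q| := by
    rw [abs_sub_comm α s]
    exact abs_sub_le _ _ _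
  have hhalf : 1 / (2 * ((q : ℝ) * s.den)) = 1 / ((q : ℝ) * s.den) / 2 := by
    rw [mul_comm 2, ← div_div]
  linarith

theorem intCast_div_natCast_ne_of_lt_den {s : ℚ} {q : ℕ} (hq : 0 < q) (h : q < s.den) (p : ℤ) :
    (p : ℚ) / q ≠ s := by
  rintro rfl
  have hdvd := Rat.den_dvd p q
  rw [Rat.divInt_eq_div, Int.cast_natCast] at hdvd
  exact h.not_ge (Nat.le_of_dvd hq (by exact_mod_cast hdvd))

end RationalApproximation

section Denominators

theorem one_lt_den_of_pos_of_lt_one {x : ℚ} (h0 : 0 < x) (h1 : x < 1) : 1 < x.den := by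
  refine lt_of_le_of_ne x.den_pos fun hden => ?_
  rw [← (Rat.den_eq_one_iff x).1 hden.symm] at h0 h1
  have hnum0 : 0 < x.num := by exact_mod_cast h0
  have hnum1 : x.num < 1 := by exact_mod_cast h1
  lia

theorem den_add_of_den_dvd_pow {x z : ℚ} {c k : ℕ} (hz : z.den = x.den * c)
    (hc : z.den ∣ c ^ k) : (x + z).den = z.den := by
  have hc0 : (c : ℚ) ≠ 0 := by
    rintro h
    exact z.den_ne_zero (by rw [hz, Nat.cast_eq_zero.1 h, mul_zero])
  have hx0 : (x.den : ℚ) ≠ 0 := by exact_mod_cast x.den_ne_zero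
  have hadd : x + z = ((x.num * c + z.num : ℤ) : ℚ) / (z.den : ℤ) := by
    conv_lhs => rw [← Rat.num_div_den x, ← Rat.num_div_den z]
    rw [hz]
    push_cast
    field_simp
  have hcop : IsCoprime (x.num * c + z.num) (z.den : ℤ) := by
    have hzc : IsCoprime z.num (c : ℤ) :=
      (Rat.isCoprime_num_den z).of_isCoprime_of_dvd_right
        (by exact_mod_cast Dvd.intro_left _ hz.symm)
    have hnum : IsCoprime (x.num * c + z.num) (c : ℤ) := by
      rw [add_comm]
      exact hzc.add_mul_right_left x.num
    have hc' : (z.den : ℤ) ∣ (c : ℤ) ^ k := by exact_mod_cast hc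
    exact hnum.pow_right.of_isCoprime_of_dvd_right hc'
  have hden := Rat.den_div_eq_of_coprime (by exact_mod_cast z.den_pos)
    (Int.isCoprime_iff_gcd_eq_one.1 hcop)
  rw [← hadd] at hden
  exact_mod_cast hden

theorem den_add_pow_of_mul_dvd {x y : ℚ} {m : ℕ} (h : x.den * y.den ∣ y.den ^ m) :
    (x + y ^ m).den = y.den ^ m := by
  obtain ⟨e, he⟩ := h
  rw [← Rat.den_pow] at he ⊢
  refine den_add_of_den_dvd_pow (k := m) (he.trans (mul_assoc _ _ _)) ?_
  rw [Rat.den_pow]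
  exact pow_dvd_pow_of_dvd (Dvd.intro e rfl) m

end Denominators

section Growth

theorem eventually_const_mul_pow_lt_pow (c : ℝ) (k : ℕ) {b : ℝ} (hb : 1 < b) :
    ∀ᶠ n : ℕ in atTop, c * (n : ℝ) ^ k < b ^ n := by
  have hlim := (tendsto_pow_const_div_const_pow_of_one_lt k hb).const_mul c
  rw [mul_zero] at hlim
  filter_upwards [hlim.eventually_lt_const one_pos] with n hn
  rwa [← mul_div_assoc, div_lt_one (by positivity)] at hn

-- Of `b ^ q = √b ^ q * √b ^ q`, one factor absorbs `T ^ T ≤ √b ^ T ^ 2`, the other `2 * q`.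
theorem eventually_two_mul_mul_self_pow_lt_pow {b : ℝ} (hb : 1 < b) :
    ∀ᶠ T : ℕ in atTop, ∀ q : ℕ, T ^ 2 ≤ q → 2 * (q * (T : ℝ) ^ T) < b ^ q := by
  have hγ : 1 < √b := Real.lt_sqrt_of_sq_lt (by simpa using hb)
  filter_upwards [eventually_const_mul_pow_lt_pow 1 1 hγ,
    eventually_forall_ge_atTop.2 (eventually_const_mul_pow_lt_pow 2 1 hγ)] with T hT hlarge q hq
  have hTγ : (T : ℝ) ≤ √b ^ T := by simpa using hT.le
  have hqγ : 2 * (q : ℝ) < √b ^ q := by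
    simpa using hlarge q ((Nat.le_self_pow two_ne_zero T).trans hq)
  calc 2 * (q * (T : ℝ) ^ T)
      = 2 * q * (T : ℝ) ^ T := (mul_assoc _ _ _).symm
    _ ≤ 2 * q * (√b ^ T) ^ T := by gcongr
    _ = 2 * q * √b ^ T ^ 2 := by rw [← pow_mul, sq]
    _ ≤ 2 * q * √b ^ q := by gcongr; exact hγ.le
    _ < √b ^ q * √b ^ q := by gcongr
    _ = b ^ q := by rw [← mul_pow, Real.mul_self_sqrt (by linarith)]

theorem eventually_exists_mem_Ico_of_strictMono {f : ℕ → ℕ} (hf : StrictMono f) {P : ℕ → Prop}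
    (hP : ∀ᶠ n in atTop, P n) :
    ∀ᶠ q in atTop, ∃ n, P n ∧ f n ≤ q ∧ q < f (n + 1) := by
  obtain ⟨n₀, hn₀⟩ := eventually_atTop.1 hP
  have hshift : StrictMono fun i => f (n₀ + i) := fun i j hij => hf (by lia)
  filter_upwards [eventually_ge_atTop (f n₀)] with q hq
  obtain ⟨i, hi, hi'⟩ := hshift.exists_between_of_tendsto_atTop hshift.tendsto_atTop
    (Nat.lt_succ_of_le hq)
  exact ⟨n₀ + i, hn₀ _ (by lia), Nat.le_of_lt_succ hi, hi'⟩

end Growth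

section Tower

variable {b : ℕ → ℕ}

theorem tower_strictMono (hb : ∀ n, 1 < b (n + 1)) : StrictMono (tower b) :=
  strictMono_nat_of_lt_succ fun n => Nat.lt_pow_self (hb n)

theorem lt_tower (hb : ∀ n, 1 < b (n + 1)) (n : ℕ) : n < tower b n :=
  (tower_strictMono hb).add_le_nat n 0

theorem tower_mul_dvd_tower_succ (hb : ∀ n, 1 < b (n + 1)) (hdvd : ∀ n, b (n + 1) ∣ b (n + 2))
    (n : ℕ) : tower b n * b (n + 1) ∣ tower b (n + 1) := by
  cases n with
  | zero => simp [tower]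
  | succ n =>
    calc b (n + 1) ^ tower b n * b (n + 2)
        ∣ b (n + 2) ^ tower b n * b (n + 2) :=
          mul_dvd_mul_right (pow_dvd_pow_of_dvd (hdvd n) _) _
      _ = b (n + 2) ^ (tower b n + 1) := (pow_succ _ _).symm
      _ ∣ b (n + 2) ^ tower b (n + 1) := pow_dvd_pow _ (tower_strictMono hb n.lt_succ_self)

theorem tower_congr {c : ℕ → ℕ} (h : ∀ n, b (n + 1) = c (n + 1)) : tower b = tower c := by
  funext n
  induction n with
  | zero => rfl
  | succ n ih => rw [tower, tower, h, ih]

end Tower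

section Series

/-- The partial sums of the series with terms `seriesTerm r`, as rational numbers: these are the
approximations to its sum whose denominators are `denTower r`. -/
def partialSum (r : ℕ → ℚ) (n : ℕ) : ℚ := ∑ i ∈ Finset.range n, r (i + 1) ^ denTower r i

theorem hasSum_seriesTerm_add {r : ℕ → ℚ} {τ : ℝ} (hτ : HasSum (seriesTerm r) τ) (n : ℕ) :
    HasSum (fun i => seriesTerm r (i + n)) (τ - partialSum r n) := by
  have hcast : (partialSum r n : ℝ) = ∑ i ∈ Finset.range n, seriesTerm r i := by
    simp [partialSum, seriesTerm]
  rw [hcast]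
  exact (hasSum_nat_add_iff' n).2 hτ

/-- The properties of `r 1, r 2, …` under which the rational approximations to the sum of the
series can be analysed. Indices are shifted by one, as `r 0` plays no role. -/
structure IsAdmissible (r : ℕ → ℚ) : Prop where
  pos (n : ℕ) : 0 < r (n + 1)
  lt_one : r 1 < 1
  antitone : Antitone fun n => r (n + 1)
  den_dvd (n : ℕ) : (r (n + 1)).den ∣ (r (n + 2)).den
  den_le : ∀ᶠ n in atTop, (r (n + 1)).den ≤ denTower r n

namespace IsAdmissible

variable {β τ : ℝ} {r : ℕ → ℚ}

theorem le_first (h : IsAdmissible r) (n : ℕ) : r (n + 1) ≤ r 1 := h.antitone n.zero_le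

theorem one_lt_den (h : IsAdmissible r) (n : ℕ) : 1 < (r (n + 1)).den :=
  one_lt_den_of_pos_of_lt_one (h.pos n) ((h.le_first n).trans_lt h.lt_one)

theorem denTower_strictMono (h : IsAdmissible r) : StrictMono (denTower r) :=
  tower_strictMono h.one_lt_den

theorem denTower_pos (h : IsAdmissible r) (n : ℕ) : 0 < denTower r n :=
  n.zero_le.trans_lt (lt_tower h.one_lt_den n)

theorem le_of_tendsto (h : IsAdmissible r) {L : ℝ}
    (hL : Tendsto (fun n => (r (n + 1) : ℝ)) atTop (𝓝 L)) (n : ℕ) : L ≤ r (n + 1) :=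
  (Rat.cast_mono.comp_antitone h.antitone).le_of_tendsto hL n

theorem den_partialSum (h : IsAdmissible r) (n : ℕ) : (partialSum r n).den = denTower r n := by
  induction n with
  | zero => rfl
  | succ n ih =>
    rw [partialSum, Finset.sum_range_succ]
    refine den_add_pow_of_mul_dvd ?_
    rw [← partialSum, ih]
    exact tower_mul_dvd_tower_succ h.one_lt_den h.den_dvd n

theorem seriesTerm_pos (h : IsAdmissible r) (n : ℕ) : 0 < seriesTerm r n :=
  pow_pos (Rat.cast_pos.2 (h.pos n)) _

theorem seriesTerm_le_pow (h : IsAdmissible r) (n : ℕ) :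
    seriesTerm r n ≤ (r 1 : ℝ) ^ denTower r n :=
  pow_le_pow_left₀ (Rat.cast_nonneg.2 (h.pos n).le) (Rat.cast_le.2 (h.le_first n)) _

theorem seriesTerm_add_le (h : IsAdmissible r) (n i : ℕ) :
    seriesTerm r (i + n) ≤ seriesTerm r n * (r 1 : ℝ) ^ i := by
  have hnonneg (m : ℕ) : (0 : ℝ) ≤ r (m + 1) := Rat.cast_nonneg.2 (h.pos m).le
  have hanti : (r (i + n + 1) : ℝ) ≤ r (n + 1) := Rat.cast_le.2 (h.antitone (by lia))
  have hle : (r (n + 1) : ℝ) ≤ r 1 := Rat.cast_le.2 (h.le_first n)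
  have hone : (r 1 : ℝ) ≤ 1 := by exact_mod_cast h.lt_one.le
  calc (r (i + n + 1) : ℝ) ^ denTower r (i + n)
      ≤ (r (n + 1) : ℝ) ^ denTower r (i + n) := pow_le_pow_left₀ (hnonneg _) hanti _
    _ ≤ (r (n + 1) : ℝ) ^ (i + denTower r n) :=
      pow_le_pow_of_le_one (hnonneg n) (hle.trans hone) (h.denTower_strictMono.add_le_nat i n)
    _ = (r (n + 1) : ℝ) ^ denTower r n * (r (n + 1) : ℝ) ^ i := by rw [pow_add, mul_comm]
    _ ≤ (r (n + 1) : ℝ) ^ denTower r n * (r 1 : ℝ) ^ i := by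
      have := hnonneg n
      gcongr

theorem hasSum_geometric (h : IsAdmissible r) :
    HasSum (fun i => (r 1 : ℝ) ^ i) (1 - (r 1 : ℝ))⁻¹ :=
  hasSum_geometric_of_lt_one (Rat.cast_nonneg.2 (h.pos 0).le) (by exact_mod_cast h.lt_one)

theorem summable_seriesTerm (h : IsAdmissible r) : Summable (seriesTerm r) :=
  .of_nonneg_of_le (fun n => (h.seriesTerm_pos n).le) (h.seriesTerm_add_le 0)
    (h.hasSum_geometric.summable.mul_left _)

theorem seriesTerm_lt_sub_partialSum (h : IsAdmissible r) (hτ : HasSum (seriesTerm r) τ) (n : ℕ) :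
    seriesTerm r n < τ - partialSum r n := by
  simpa using lt_hasSum (hasSum_seriesTerm_add hτ n) 0 (fun i _ => (h.seriesTerm_pos _).le) 1
    one_ne_zero (h.seriesTerm_pos _)

theorem abs_sub_partialSum_le (h : IsAdmissible r) (hτ : HasSum (seriesTerm r) τ) (n : ℕ) :
    |τ - partialSum r n| ≤ (1 - (r 1 : ℝ))⁻¹ * seriesTerm r n := by
  rw [abs_of_pos ((h.seriesTerm_pos n).trans (h.seriesTerm_lt_sub_partialSum hτ n)), mul_comm]
  exact hasSum_le (h.seriesTerm_add_le n) (hasSum_seriesTerm_add hτ n)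
    (h.hasSum_geometric.mul_left _)

theorem one_div_pow_lt_abs_sub_partialSum (h : IsAdmissible r) (hτ : HasSum (seriesTerm r) τ)
    (hβ : 0 < β) {n : ℕ} (hn : 1 / β ≤ r (n + 1)) :
    1 / β ^ denTower r n < |τ - partialSum r n| :=
  calc 1 / β ^ denTower r n = (1 / β) ^ denTower r n := (one_div_pow _ _).symm
    _ ≤ seriesTerm r n := pow_le_pow_left₀ (by positivity) hn _
    _ < τ - partialSum r n := h.seriesTerm_lt_sub_partialSum hτ n
    _ ≤ |τ - partialSum r n| := le_abs_self _

theorem eventually_abs_sub_partialSum_le (h : IsAdmissible r) (hτ : HasSum (seriesTerm r) τ) :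
    ∀ᶠ n in atTop, |τ - partialSum r n| ≤ 1 / (2 * (denTower r n : ℝ) ^ 3) := by
  set C : ℝ := (1 - (r 1 : ℝ))⁻¹
  have hr0 : (0 : ℝ) < r 1 := Rat.cast_pos.2 (h.pos 0)
  have hr1 : (r 1 : ℝ) < 1 := by exact_mod_cast h.lt_one
  have hC : 0 ≤ C := inv_nonneg.2 (by linarith)
  filter_upwards [h.denTower_strictMono.tendsto_atTop.eventually
    (eventually_const_mul_pow_lt_pow (2 * C) 3 (one_lt_inv₀ hr0 |>.2 hr1))] with n hn
  have hT : (0 : ℝ) < denTower r n := by exact_mod_cast h.denTower_pos n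
  calc |τ - partialSum r n|
      ≤ C * seriesTerm r n := h.abs_sub_partialSum_le hτ n
    _ ≤ C * (r 1 : ℝ) ^ denTower r n := mul_le_mul_of_nonneg_left (h.seriesTerm_le_pow n) hC
    _ ≤ 1 / (2 * (denTower r n : ℝ) ^ 3) := by
      rw [le_div_iff₀ (by positivity)]
      rw [inv_pow, ← one_div, lt_div_iff₀ (by positivity)] at hn
      linarith

theorem eventually_one_div_le_abs_sub_div (h : IsAdmissible r) (hτ : HasSum (seriesTerm r) τ) :
    ∀ᶠ n in atTop, ∀ (p : ℤ) (q : ℕ), 0 < q → q ≤ denTower r n ^ 2 →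
      (p : ℚ) / q ≠ partialSum r n → 1 / (2 * ((q : ℝ) * denTower r n)) ≤ |τ - p / q| := by
  filter_upwards [h.eventually_abs_sub_partialSum_le hτ] with n hn p q hq hqn hne
  have hqn' : (q : ℝ) ≤ (denTower r n : ℝ) ^ 2 := by exact_mod_cast hqn
  have hT : (0 : ℝ) < denTower r n := by exact_mod_cast h.denTower_pos n
  rw [← h.den_partialSum n] at hT hqn' hn ⊢
  refine one_div_two_mul_le_abs_sub_of_ne _ p hq hne (hn.trans ?_)
  rw [pow_succ]
  gcongr

theorem avoidsRationals (h : IsAdmissible r) (hτ : HasSum (seriesTerm r) τ) (hβ : 1 < β)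
    (hle : ∀ n, 1 / β ≤ r (n + 1)) : AvoidsRationals τ β := by
  have hmono := h.denTower_strictMono
  have hfar := h.eventually_one_div_le_abs_sub_div hτ
  have hgrowth := hmono.tendsto_atTop.eventually (eventually_two_mul_mul_self_pow_lt_pow hβ)
  rw [avoidsRationals_iff_eventually]
  filter_upwards [eventually_gt_atTop 0, eventually_const_mul_pow_lt_pow 2 2 hβ,
    eventually_exists_mem_Ico_of_strictMono hmono
      ((hfar.and ((tendsto_add_atTop_nat 1).eventually hfar)).and (h.den_le.and hgrowth))]
    with q hq hqβ ⟨n, ⟨⟨hfar_n, hfar_succ⟩, hden, hgrowth_n⟩, hnq, hqn⟩ p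
  by_cases hp : (p : ℚ) / q = partialSum r n
  · have hp' : (p : ℝ) / q = partialSum r n := by exact_mod_cast congrArg (Rat.cast : ℚ → ℝ) hp
    rw [hp']
    exact (one_div_pow_le_one_div_pow_of_le hβ.le hnq).trans_lt
      (h.one_div_pow_lt_abs_sub_partialSum hτ (by linarith) (hle n))
  have hT (m : ℕ) : (0 : ℝ) < denTower r m := by exact_mod_cast h.denTower_pos m
  rcases le_total q (denTower r n ^ 2) with hsmall | hlarge
  · refine (one_div_lt_one_div_of_lt (mul_pos two_pos (mul_pos (by positivity) (hT n))) ?_).trans_le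
      (hfar_n p q hq hsmall hp)
    calc 2 * ((q : ℝ) * denTower r n) ≤ 2 * (q * q) := by gcongr
      _ = 2 * (q : ℝ) ^ 2 := by rw [sq]
      _ < β ^ q := hqβ
  · have hp_succ : (p : ℚ) / q ≠ partialSum r (n + 1) :=
      intCast_div_natCast_ne_of_lt_den hq (by rwa [h.den_partialSum]) p
    have hsmall : q ≤ denTower r (n + 1) ^ 2 := hqn.le.trans (Nat.le_self_pow two_ne_zero _)
    refine (one_div_lt_one_div_of_lt
      (mul_pos two_pos (mul_pos (by positivity) (hT (n + 1)))) ?_).trans_le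
      (hfar_succ p q hq hsmall hp_succ)
    have hstep : denTower r (n + 1) ≤ denTower r n ^ denTower r n := Nat.pow_le_pow_left hden _
    calc 2 * ((q : ℝ) * denTower r (n + 1)) ≤ 2 * (q * (denTower r n : ℝ) ^ denTower r n) := by
          gcongr; exact_mod_cast hstep
      _ < β ^ q := hgrowth_n q hlarge

theorem not_avoidsRationals_of_lt (h : IsAdmissible r) (hτ : HasSum (seriesTerm r) τ) (hβ : 0 < β)
    (hlim : Tendsto (fun n => (r (n + 1) : ℝ)) atTop (𝓝 (1 / β))) {b : ℝ} (hb : 0 < b)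
    (hbβ : b < β) : ¬ AvoidsRationals τ b := by
  rintro ⟨Q, -, hQ⟩
  set C : ℝ := (1 - (r 1 : ℝ))⁻¹
  have hC : 0 ≤ C := inv_nonneg.2 (sub_nonneg.2 (by exact_mod_cast h.lt_one.le))
  have hT := h.denTower_strictMono.tendsto_atTop
  obtain ⟨c, hbc, hc1⟩ := exists_between ((div_lt_one hβ).2 hbβ)
  have hrc : ∀ᶠ n in atTop, (r (n + 1) : ℝ) * b < c :=
    (hlim.mul_const b).eventually_lt_const (by rwa [one_div_mul_eq_div])
  have hCc : ∀ᶠ n in atTop, C * c ^ denTower r n < 1 := by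
    have hlim0 := ((tendsto_pow_atTop_nhds_zero_of_lt_one ((div_pos hb hβ).trans hbc).le hc1).comp
      hT).const_mul C
    rw [mul_zero] at hlim0
    exact hlim0.eventually_lt_const one_pos
  obtain ⟨n, hrc, hCc, hQn⟩ := (hrc.and (hCc.and (hT.eventually_ge_atTop Q))).exists
  have hfar := hQ (partialSum r n).num (partialSum r n).den (by rwa [h.den_partialSum])
  rw [← Rat.cast_def, h.den_partialSum, div_lt_iff₀ (by positivity)] at hfar
  have hr : (0 : ℝ) ≤ r (n + 1) := Rat.cast_nonneg.2 (h.pos n).le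
  have hnear : |τ - partialSum r n| * b ^ denTower r n < 1 :=
    calc |τ - partialSum r n| * b ^ denTower r n
        ≤ C * seriesTerm r n * b ^ denTower r n := by
          gcongr; exact h.abs_sub_partialSum_le hτ n
      _ = C * (r (n + 1) * b) ^ denTower r n := by rw [seriesTerm, mul_pow, mul_assoc]
      _ ≤ C * c ^ denTower r n := by gcongr
      _ < 1 := hCc
  exact lt_asymm hfar hnear

theorem of_const {x : ℚ} (h0 : 0 < x) (h1 : x < 1) (hr : ∀ n, r (n + 1) = x) :
    IsAdmissible r where
  pos n := by rwa [hr]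
  lt_one := by rwa [hr]
  antitone := by simp only [hr]; exact antitone_const
  den_dvd n := by rw [hr, hr]
  den_le := by
    have hden (n : ℕ) : 1 < (r (n + 1)).den := by
      rw [hr]; exact one_lt_den_of_pos_of_lt_one h0 h1
    filter_upwards [eventually_ge_atTop x.den] with n hn
    rw [hr]
    exact hn.trans (lt_tower hden n).le

end IsAdmissible

theorem seriesTerm_of_const {r : ℕ → ℚ} {x : ℚ} (hr : ∀ n, r (n + 1) = x) (n : ℕ) :
    seriesTerm r n = (x : ℝ) ^ tower (fun _ => x.den) n := by
  rw [seriesTerm, hr, denTower, tower_congr (c := fun _ => x.den) fun n => by rw [hr]]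

end Series

section BinaryExpansion

variable {x : ℝ} {k : ℕ → ℕ}

/-- The value `1 - S (j + 1)` which a constructed sequence takes on its block
`N j < n ≤ N (j + 1)`. -/
def blockValue (k : ℕ → ℕ) (j : ℕ) : ℚ := 1 - ∑ i ∈ Finset.range (j + 1), 1 / (2 : ℚ) ^ k i

theorem IsBinaryExpansion.pos (h : IsBinaryExpansion x k) (j : ℕ) : 0 < k j :=
  h.1.trans_le (h.2.1.monotone j.zero_le)

theorem blockValue_antitone (k : ℕ → ℕ) : Antitone (blockValue k) := by
  refine antitone_nat_of_succ_le fun j => ?_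
  rw [blockValue, blockValue, Finset.sum_range_succ _ (j + 1)]
  exact sub_le_sub_left (le_add_of_nonneg_right (by positivity)) _

theorem blockValue_lt_one (k : ℕ → ℕ) (j : ℕ) : blockValue k j < 1 :=
  sub_lt_self _ (Finset.sum_pos (fun i _ => by positivity) Finset.nonempty_range_add_one)

theorem cast_blockValue (k : ℕ → ℕ) (j : ℕ) :
    (blockValue k j : ℝ) = 1 - ∑ i ∈ Finset.range (j + 1), 1 / (2 : ℝ) ^ k i := by
  simp [blockValue]

theorem tendsto_blockValue (h : IsBinaryExpansion x k) :
    Tendsto (fun j => (blockValue k j : ℝ)) atTop (𝓝 (1 - x)) := by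
  simp only [cast_blockValue]
  exact (h.2.2.tendsto_sum_nat.comp (tendsto_add_atTop_nat 1)).const_sub 1

theorem blockValue_pos (h : IsBinaryExpansion x k) (hx : x < 1) (j : ℕ) : 0 < blockValue k j := by
  have hanti : Antitone fun j => (blockValue k j : ℝ) := Rat.cast_mono.comp_antitone
    (blockValue_antitone k)
  have hle : 1 - x ≤ blockValue k j := hanti.le_of_tendsto (tendsto_blockValue h) j
  exact Rat.cast_pos.1 ((sub_pos.2 hx).trans_le hle)

theorem den_sum_one_div_two_pow (h0 : 0 < k 0) (hk : StrictMono k) (j : ℕ) :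
    (∑ i ∈ Finset.range (j + 1), 1 / (2 : ℚ) ^ k i).den = 2 ^ k j := by
  have hhalf : (1 / 2 : ℚ).den = 2 := by norm_num
  have hadd {x : ℚ} {m : ℕ} (hx : x.den * 2 ∣ 2 ^ m) : (x + 1 / 2 ^ m).den = 2 ^ m := by
    have hden := den_add_pow_of_mul_dvd (x := x) (y := 1 / 2) (m := m) (by rwa [hhalf])
    rwa [hhalf, one_div_pow] at hden
  induction j with
  | zero =>
    rw [Finset.sum_range_succ, Finset.sum_range_zero]
    exact hadd (by rw [Rat.den_zero, one_mul]; exact dvd_pow_self 2 h0.ne')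
  | succ j ih =>
    rw [Finset.sum_range_succ]
    refine hadd ?_
    rw [ih, ← pow_succ]
    exact pow_dvd_pow _ (hk j.lt_succ_self)

theorem den_blockValue (h0 : 0 < k 0) (hk : StrictMono k) (j : ℕ) :
    (blockValue k j).den = 2 ^ k j := by
  rw [blockValue, ← den_sum_one_div_two_pow h0 hk]
  exact_mod_cast Rat.intCast_sub_den 1 _

theorem ofDigitsTerm_two (d : ℕ → Fin 2) (i : ℕ) :
    Real.ofDigitsTerm d i = if d i = 1 then 1 / 2 ^ (i + 1) else 0 := by
  split_ifs with hi
  · simp [Real.ofDigitsTerm, hi]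
  · have hi0 : d i = 0 := by lia
    simp [Real.ofDigitsTerm, hi0]

theorem infinite_setOf_eq_one_of_hasSum_ofDigitsTerm {d : ℕ → Fin 2} (hx : Irrational x)
    (hd : HasSum (Real.ofDigitsTerm d) x) : {i | d i = 1}.Infinite := by
  intro hfin
  have hfinsum : x = ∑ i ∈ hfin.toFinset, Real.ofDigitsTerm d i :=
    hd.unique (hasSum_sum_of_ne_finset_zero fun i hi => by
      rw [ofDigitsTerm_two, if_neg (by simpa using hi)])
  refine hx ⟨∑ i ∈ hfin.toFinset, if d i = 1 then 1 / 2 ^ (i + 1) else 0, ?_⟩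
  simp only [hfinsum, ofDigitsTerm_two, Rat.cast_sum, apply_ite (Rat.cast : ℚ → ℝ)]
  norm_num

theorem exists_isBinaryExpansion (hx : Irrational x) (h0 : 0 < x) (h1 : x < 1) :
    ∃ k, IsBinaryExpansion x k := by
  have hd := Real.hasSum_ofDigitsTerm_digits x one_lt_two ⟨h0.le, h1⟩
  set d := Real.digits x 2
  have hinf : (Set.ofPred fun i => d i = 1).Infinite :=
    infinite_setOf_eq_one_of_hasSum_ofDigitsTerm hx hd
  have hmono := Nat.nth_strictMono hinf
  refine ⟨fun i => Nat.nth (fun i => d i = 1) i + 1, Nat.succ_pos _, hmono.add_const 1, ?_⟩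
  have hsub := (hmono.injective.hasSum_iff fun i hi => ?_).2 hd
  · refine hsub.congr_fun fun i => ?_
    rw [Function.comp_apply, ofDigitsTerm_two, if_pos (Nat.nth_mem_of_infinite hinf i)]
  · rw [Nat.range_nth_of_infinite hinf] at hi
    exact (ofDigitsTerm_two d i).trans (if_neg fun h => hi h)

end BinaryExpansion

section Blocks

variable {x : ℝ} {r : ℕ → ℚ} {k N : ℕ → ℕ}

/-- The index `j` of the block `N j ≤ n < N (j + 1)` containing `n`. It refers to `r (n + 1)`, so
that it is the block `N j < n + 1 ≤ N (j + 1)` of the construction. -/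
def blockIndex (N : ℕ → ℕ) (n : ℕ) : ℕ := Nat.findGreatest (fun j => N j ≤ n) n

theorem gc_blockIndex (h0 : N 0 = 0) (hN : StrictMono N) : GaloisConnection N (blockIndex N) := by
  refine fun j n => ⟨fun hj => Nat.le_findGreatest (hN.le_apply.trans hj) hj, fun hj => ?_⟩
  have hspec : N (blockIndex N n) ≤ n :=
    Nat.findGreatest_spec (P := fun j => N j ≤ n) n.zero_le (h0.trans_le n.zero_le)
  exact (hN.monotone hj).trans hspec

theorem blockIndex_eq (h0 : N 0 = 0) (hN : StrictMono N) {j n : ℕ} (hj : N j ≤ n)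
    (hj' : n < N (j + 1)) : blockIndex N n = j := by
  have hgc := gc_blockIndex h0 hN
  exact le_antisymm (Nat.lt_succ_iff.1 (hgc.lt_iff_lt.1 hj')) (hgc.le_u hj)

theorem tendsto_blockIndex (h0 : N 0 = 0) (hN : StrictMono N) :
    Tendsto (blockIndex N) atTop atTop :=
  tendsto_atTop.2 fun j =>
    (eventually_ge_atTop (N j)).mono fun _ hn => (gc_blockIndex h0 hN).le_u hn

theorem IsAdmissible.of_blocks (hk : IsBinaryExpansion x k) (hx : x < 1) (h0 : N 0 = 0)
    (hN : StrictMono N) (hr : ∀ n, r (n + 1) = blockValue k (blockIndex N n))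
    (hlong : ∀ j, 2 ^ k (j + 1) ≤ denTower r (N (j + 1))) : IsAdmissible r := by
  have hgc := gc_blockIndex h0 hN
  have hden (n : ℕ) : (r (n + 1)).den = 2 ^ k (blockIndex N n) := by
    rw [hr, den_blockValue hk.1 hk.2.1]
  refine ⟨fun n => ?_, ?_, ?_, fun n => ?_, ?_⟩
  · rw [hr]
    exact blockValue_pos hk hx _
  · rw [hr]
    exact blockValue_lt_one k _
  · simp only [hr]
    exact (blockValue_antitone k).comp_monotone hgc.monotone_u
  · rw [hden, hden]
    exact pow_dvd_pow _ (hk.2.1.monotone (hgc.monotone_u n.le_succ))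
  · filter_upwards [(tendsto_blockIndex h0 hN).eventually_gt_atTop 0] with n hn
    obtain ⟨j, hj⟩ := Nat.exists_eq_succ_of_ne_zero hn.ne'
    have hmono : StrictMono (denTower r) := tower_strictMono fun n => by
      rw [hden]
      exact Nat.one_lt_two_pow (hk.pos _).ne'
    rw [hden, hj]
    exact (hlong j).trans (hmono.monotone (hgc.l_le hj.ge))

theorem exists_blocks (hk0 : 0 < k 0) (hk : StrictMono k) :
    ∃ N : ℕ → ℕ, N 0 = 0 ∧ StrictMono N ∧
      ∀ r : ℕ → ℚ, (∀ n, r (n + 1) = blockValue k (blockIndex N n)) →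
        ∀ j, 2 ^ k (j + 1) ≤ denTower r (N (j + 1)) := by
  refine ⟨fun j => j * 2 ^ k j, zero_mul _, strictMono_nat_of_lt_succ fun j => ?_,
    fun r hr j => ?_⟩
  · have hpow : 2 ^ k j ≤ 2 ^ k (j + 1) := Nat.pow_le_pow_right two_pos (hk.monotone j.le_succ)
    exact Nat.mul_lt_mul_of_lt_of_le j.lt_succ_self hpow (by positivity)
  · have hden (n : ℕ) : 1 < (r (n + 1)).den := by
      rw [hr, den_blockValue hk0 hk]
      exact Nat.one_lt_two_pow (hk0.trans_le (hk.monotone (Nat.zero_le _))).ne'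
    exact (Nat.le_mul_of_pos_left _ j.succ_pos).trans (lt_tower hden _).le

end Blocks

section Construction

variable {β : ℝ} {r : ℕ → ℚ}

theorem exists_isConstructedSequence_of_irrational (hβ : 1 < β) (hirr : Irrational β) :
    ∃ r : ℕ → ℚ, IsConstructedSequence β r := by
  have hx : Irrational (1 - 1 / β) := by
    rw [one_div]
    exact_mod_cast hirr.inv.ratCast_sub 1
  have hx0 : 0 < 1 - 1 / β := sub_pos.2 ((div_lt_one (by linarith)).2 hβ)
  have hx1 : 1 - 1 / β < 1 := sub_lt_self _ (by positivity)
  obtain ⟨k, hk⟩ := exists_isBinaryExpansion hx hx0 hx1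
  obtain ⟨N, hN0, hN, hlong⟩ := exists_blocks hk.1 hk.2.1
  refine ⟨fun n => blockValue k (blockIndex N (n - 1)),
    .irrational hirr k N hk hN0 hN (fun j n hj hj' => ?_) (hlong _ fun n => rfl)⟩
  rw [blockIndex_eq hN0 hN (j := j) (by lia) (by lia), blockValue]

theorem exists_isConstructedSequence_ratCast {x : ℚ} (hx : 1 < x) :
    ∃ r : ℕ → ℚ, IsConstructedSequence x r := by
  obtain ⟨b, hb⟩ := Int.eq_ofNat_of_zero_le (Rat.num_nonneg.2 (zero_le_one.trans hx.le))
  have hxb : x = (b : ℚ) / x.den := by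
    conv_lhs => rw [← Rat.num_div_den x, hb, Int.cast_natCast]
  refine ⟨fun _ => (x.den : ℚ) / b, .rational x.den b x.den_pos ?_ ?_ ?_ fun _ _ => rfl⟩
  · rw [hxb, one_lt_div (by exact_mod_cast x.den_pos)] at hx
    exact_mod_cast hx
  · simpa [hb] using x.reduced.symm
  · simpa only [Rat.cast_div, Rat.cast_natCast] using congrArg (Rat.cast : ℚ → ℝ) hxb

theorem exists_isConstructedSequence (hβ : 1 < β) : ∃ r : ℕ → ℚ, IsConstructedSequence β r := by
  by_cases hirr : Irrational β
  · exact exists_isConstructedSequence_of_irrational hβ hirr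
  · obtain ⟨x, rfl⟩ : ∃ x : ℚ, (x : ℝ) = β := by simpa [Irrational] using hirr
    exact exists_isConstructedSequence_ratCast (by exact_mod_cast hβ)

namespace IsConstructedSequence

theorem eq_inv_of_ratCast {x : ℚ} (h : IsConstructedSequence x r) (n : ℕ) : r (n + 1) = x⁻¹ := by
  cases h with
  | irrational hirr => exact absurd ⟨x, rfl⟩ hirr
  | rational a b _ _ _ hx hr =>
    have hx' : x = (b : ℚ) / a :=
      Rat.cast_injective (α := ℝ) (by simpa only [Rat.cast_div, Rat.cast_natCast] using hx)
    rw [hr _ n.succ_pos, hx', inv_div]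

theorem isAdmissible_and_tendsto (h : IsConstructedSequence β r) (hβ : 0 < β) :
    IsAdmissible r ∧ Tendsto (fun n => (r (n + 1) : ℝ)) atTop (𝓝 (1 / β)) := by
  cases h with
  | rational a b ha hab _ hβ_eq hr =>
    have hr' (n : ℕ) : r (n + 1) = (a : ℚ) / b := hr _ n.succ_pos
    have hb : (0 : ℚ) < b := by exact_mod_cast ha.trans hab
    refine ⟨.of_const (by positivity) ((div_lt_one hb).2 (by exact_mod_cast hab)) hr', ?_⟩
    simp [hr', hβ_eq]
  | irrational _ k N hk hN0 hN hr hlong =>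
    have hr' (n : ℕ) : r (n + 1) = blockValue k (blockIndex N n) := by
      have hgc := gc_blockIndex hN0 hN
      exact hr _ _ (Nat.lt_succ_of_le (hgc.l_u_le n)) (hgc.lt_iff_lt.2 (Nat.lt_succ_self _))
    refine ⟨.of_blocks hk (sub_lt_self _ (by positivity)) hN0 hN hr' hlong, ?_⟩
    simpa only [hr', Function.comp_def, sub_sub_cancel] using
      (tendsto_blockValue hk).comp (tendsto_blockIndex hN0 hN)

theorem seriesTerm_eq_rpow {a b : ℕ} (h : IsConstructedSequence ((b : ℝ) / a) r) (ha : 0 < a)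
    (hb : 0 < b) (hab : Nat.Coprime b a) (n : ℕ) :
    seriesTerm r n = ((b : ℝ) / a) ^ (-(tower (fun _ => b) n : ℝ)) := by
  have h' : IsConstructedSequence ((b / a : ℚ) : ℝ) r := by
    simpa only [Rat.cast_div, Rat.cast_natCast] using h
  have hr (n : ℕ) : r (n + 1) = (a : ℚ) / b := by rw [h'.eq_inv_of_ratCast, inv_div]
  have hden : ((a : ℚ) / b).den = b := by
    have hb' : (0 : ℤ) < b := by exact_mod_cast hb
    exact Int.natCast_inj.1 (Rat.den_div_eq_of_coprime (a := a) hb' (by simpa using hab.symm))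
  rw [seriesTerm_of_const hr, hden, Real.rpow_neg (by positivity), Real.rpow_natCast, ← inv_pow,
    inv_div]
  push_cast
  rfl

end IsConstructedSequence

end Construction

theorem theorem4 (β : ℝ) (hβ : 1 < β) :
    (∃ r : ℕ → ℚ, IsConstructedSequence β r) ∧
    ∀ r : ℕ → ℚ, IsConstructedSequence β r →
      ∃ τ : ℝ, HasSum (seriesTerm r) τ ∧
        HasIrrationalityBase τ β ∧
        (∃ Q : ℕ, 0 < Q ∧
          ∀ (p : ℤ) (q : ℕ), Q ≤ q → 1 / β ^ q < |τ - (p : ℝ) / (q : ℝ)|) ∧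
        ¬ ApproximableToOrder τ (fun x => β ^ (-x)) ∧
        ∀ a b : ℕ, 0 < b → Nat.Coprime b a → β = (b : ℝ) / (a : ℝ) →
          HasSum (fun n : ℕ => β ^ (-(tower (fun _ => b) n : ℝ))) τ := by
  refine ⟨exists_isConstructedSequence hβ, fun r hr => ?_⟩
  have hβ0 : 0 < β := zero_lt_one.trans hβ
  obtain ⟨hadm, hlim⟩ := hr.isAdmissible_and_tendsto hβ0
  have hτ := hadm.summable_seriesTerm.hasSum
  have havoid := hadm.avoidsRationals hτ hβ (hadm.le_of_tendsto hlim)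
  refine ⟨_, hτ, havoid.hasIrrationalityBase hβ0 fun b hb hbβ =>
    hadm.not_avoidsRationals_of_lt hτ hβ0 hlim hb hbβ, havoid,
    havoid.not_approximableToOrder hβ0.le, fun a b hb hab hβ_eq => ?_⟩
  subst hβ_eq
  have ha : 0 < a := Nat.pos_of_ne_zero (by rintro rfl; simp at hβ0)
  exact hτ.congr_fun fun n => (hr.seriesTerm_eq_rpow ha hb hab n).symm
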